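/- Let $w=(w_j)_{j\ge1}$ be a positive non-increasing sequence with $w_1=1$, $\lim_{j\to\infty}w_j=0$ and $\sum_{j=1}^\infty w_j=\infty$. The Azimi–Hagler space $X(w)$ is the Banach space of all (real or complex) scalar sequences $x=(x_j)_{j\ge1}$ with $$\|x\|=\sup\Big\{\sum_{j=1}^n w_j\Big|\sum_{k\in F_j}x_k\Big| : n\in\mathbf N,\ F_1<\dots<F_n \text{ finite intervals of } \mathbf N\Big\}<\infty .$$ Let $(e_n)$ be the coordinate basis of $X(w)$ and put $z_n=e_{2n}-e_{2n-1}$ for $n\ge 1$. A bounded operator is weakly compact if it maps the closed unit ball to a relatively weakly compact set. A Banach space $E$ has the weakly compact approximation property (W.A.P.) if there is $C<\infty$ such that for every weakly compact set $D\subset E$ and every $\varepsilon>0$ there is a weakly compact operator $V:E\to E$ with $\sup_{x\in D}\|x-Vx\|<\varepsilon$ and $\|V\|\le C$; $E$ has the unbounded W.A.P. if the same holds without the requirement $\|V\|\le C$. Then: 1. the set $\{z_n:n\ge1\}\cup\{0\}$ is weakly compact in $X(w)$; 2. every bounded operator $V:X(w)\to X(w)$ with $\sup_{n}\|z_n-Vz_n\|<\frac1{10}$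 fixes a copy of $\ell^1$ contained in the closed linear span $[z_n:n\ge1]$ (that is, there is a subspace $M\subset[z_n:n\ge1]$ isomorphic to $\ell^1$ such that the restriction of $V$ to $M$ is an isomorphism onto $V(M)$), and in particular $V$ is not weakly compact; 3. $X(w)$ does not have the unbounded W.A.P.; 4. $X(w)$ does not have the W.A.P. -/

import Mathlib

open Filter Topology

noncomputable section

section WeakCompactness

variable (𝕜 : Type*) [RCLike 𝕜] {E F : Type*} [NormedAddCommGroup E] [NormedSpace 𝕜 E]
  [NormedAddCommGroup F] [NormedSpace 𝕜 F]

/-- A subset of a normed space is weakly compact if it is compact in the weak topology. -/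
def IsWeaklyCompact (D : Set E) : Prop :=
  IsCompact (toWeakSpace 𝕜 E '' D)

variable {𝕜}

/-- A bounded operator is weakly compact if it maps the closed unit ball to a relatively weakly
compact set. -/
def IsWeaklyCompactOperator (V : E →L[𝕜] F) : Prop :=
  IsCompact (closure (toWeakSpace 𝕜 F '' (V '' Metric.closedBall (0 : E) 1)))

/-- `sup_{x ∈ D} ‖x - V x‖ < ε` -/
def ApproximatesIdOn (V : E →L[𝕜] E) (D : Set E) (ε : ℝ) : Prop :=
  ∃ δ < ε, ∀ x ∈ D, ‖x - V x‖ ≤ δ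

/-- `V` fixes a copy of `ℓ¹` contained in `M`: there is an isomorphic embedding `T` of `ℓ¹`
with range in `M` such that `V` is bounded below on the range of `T`. -/
def FixesEllOneCopyIn (V : E →L[𝕜] F) (M : Submodule 𝕜 E) : Prop :=
  ∃ T : lp (fun _ : ℕ => 𝕜) 1 →L[𝕜] E, (∀ a, T a ∈ M) ∧
    ∃ c > (0 : ℝ), (∀ a, c * ‖a‖ ≤ ‖T a‖) ∧ (∀ a, c * ‖T a‖ ≤ ‖V (T a)‖)

variable (𝕜 E)

/-- The (bounded) weakly compact approximation property. -/
def HasWAP : Prop :=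
  ∃ C : ℝ, ∀ D : Set E, IsWeaklyCompact 𝕜 D → ∀ ε : ℝ, 0 < ε →
    ∃ V : E →L[𝕜] E, IsWeaklyCompactOperator V ∧ ApproximatesIdOn V D ε ∧ ‖V‖ ≤ C

/-- The unbounded weakly compact approximation property. -/
def HasUnboundedWAP : Prop :=
  ∀ D : Set E, IsWeaklyCompact 𝕜 D → ∀ ε : ℝ, 0 < ε →
    ∃ V : E →L[𝕜] E, IsWeaklyCompactOperator V ∧ ApproximatesIdOn V D ε

end WeakCompactness

/-- Positive non-increasing weights `w` with first term `1`, limit `0` and divergent sum.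
(Sequences are indexed from `0`.) -/
structure AzimiHaglerWeight where
  toFun : ℕ → ℝ
  pos : ∀ j, 0 < toFun j
  antitone : Antitone toFun
  first : toFun 0 = 1
  tendsto_zero : Tendsto toFun atTop (𝓝 0)
  tendsto_sum : Tendsto (fun n => ∑ j ∈ Finset.range n, toFun j) atTop atTop

/-- `F 0 < F 1 < ... < F (n - 1)` are successive (non-empty) finite intervals of `ℕ`. -/
def IsIntervalChain {n : ℕ} (F : Fin n → Finset ℕ) : Prop :=
  (∀ i, ∃ a b, a ≤ b ∧ F i = Finset.Icc a b) ∧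
    ∀ i j, i < j → ∀ s ∈ F i, ∀ t ∈ F j, s < t

namespace AzimiHagler

section Space

variable {𝕜 : Type*} [RCLike 𝕜]

/-- `∑ j, w j * |∑ k ∈ F j, x k|` -/
def chainSum (w : AzimiHaglerWeight) (x : ℕ → 𝕜) {n : ℕ} (F : Fin n → Finset ℕ) : ℝ :=
  ∑ j : Fin n, w.toFun j * ‖∑ k ∈ F j, x k‖

/-- The set whose supremum is the norm of `x`. -/
def chainSums (w : AzimiHaglerWeight) (x : ℕ → 𝕜) : Set ℝ :=
  {r | ∃ (n : ℕ) (F : Fin n → Finset ℕ), IsIntervalChain F ∧ r = chainSum w x F}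

lemma chainSum_nonneg (w : AzimiHaglerWeight) (x : ℕ → 𝕜) {n : ℕ} (F : Fin n → Finset ℕ) :
    0 ≤ chainSum w x F :=
  Finset.sum_nonneg fun j _ => mul_nonneg (w.pos j).le (norm_nonneg _)

lemma chainSum_zero (w : AzimiHaglerWeight) {n : ℕ} (F : Fin n → Finset ℕ) :
    chainSum w (0 : ℕ → 𝕜) F = 0 := by
  simp [chainSum]

lemma chainSum_add_le (w : AzimiHaglerWeight) (x y : ℕ → 𝕜) {n : ℕ} (F : Fin n → Finset ℕ) :
    chainSum w (x + y) F ≤ chainSum w x F + chainSum w y F := by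
  unfold chainSum
  rw [← Finset.sum_add_distrib]
  refine Finset.sum_le_sum fun j _ => ?_
  rw [← mul_add]
  refine mul_le_mul_of_nonneg_left ?_ (w.pos j).le
  simp only [Pi.add_apply, Finset.sum_add_distrib]
  exact norm_add_le _ _

lemma chainSum_smul (w : AzimiHaglerWeight) (c : 𝕜) (x : ℕ → 𝕜) {n : ℕ}
    (F : Fin n → Finset ℕ) : chainSum w (c • x) F = ‖c‖ * chainSum w x F := by
  unfold chainSum
  rw [Finset.mul_sum]
  refine Finset.sum_congr rfl fun j _ => ?_
  simp only [Pi.smul_apply, ← Finset.smul_sum, norm_smul]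
  ring

lemma chainSums_nonempty (w : AzimiHaglerWeight) (x : ℕ → 𝕜) : (chainSums w x).Nonempty :=
  ⟨_, 0, Fin.elim0, ⟨fun i => i.elim0, fun i => i.elim0⟩, rfl⟩

variable (𝕜) in
/-- The scalar sequences of finite norm. -/
def submodule (w : AzimiHaglerWeight) : Submodule 𝕜 (ℕ → 𝕜) where
  carrier := {x | BddAbove (chainSums w x)}
  zero_mem' := ⟨0, by rintro _ ⟨n, F, -, rfl⟩; rw [chainSum_zero]⟩
  add_mem' := by
    rintro x y ⟨A, hA⟩ ⟨B, hB⟩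
    refine ⟨A + B, ?_⟩
    rintro _ ⟨n, F, hF, rfl⟩
    exact (chainSum_add_le w x y F).trans
      (add_le_add (hA ⟨n, F, hF, rfl⟩) (hB ⟨n, F, hF, rfl⟩))
  smul_mem' := by
    rintro c x ⟨A, hA⟩
    refine ⟨‖c‖ * A, ?_⟩
    rintro _ ⟨n, F, hF, rfl⟩
    rw [chainSum_smul]
    exact mul_le_mul_of_nonneg_left (hA ⟨n, F, hF, rfl⟩) (norm_nonneg c)

end Space

end AzimiHagler

/-- The Azimi–Hagler space `X(w)` of the scalar sequences `x` with
`‖x‖ = sup ∑ j < n, w j * |∑ k ∈ F j, x k| < ∞`, the supremum over all `n` and all finite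
intervals `F 0 < ... < F (n - 1)`. -/
def AzimiHaglerSpace (𝕜 : Type*) [RCLike 𝕜] (w : AzimiHaglerWeight) : Type _ :=
  ↥(AzimiHagler.submodule 𝕜 w)

namespace AzimiHagler

section Norm

variable {𝕜 : Type*} [RCLike 𝕜] {w : AzimiHaglerWeight}

instance : AddCommGroup (AzimiHaglerSpace 𝕜 w) :=
  inferInstanceAs (AddCommGroup ↥(submodule 𝕜 w))

instance : Module 𝕜 (AzimiHaglerSpace 𝕜 w) :=
  inferInstanceAs (Module 𝕜 ↥(submodule 𝕜 w))

/-- The sequence of coordinates of an element of `X(w)`. -/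
def coords (x : AzimiHaglerSpace 𝕜 w) : ℕ → 𝕜 := Subtype.val x

lemma coords_add (x y : AzimiHaglerSpace 𝕜 w) : coords (x + y) = coords x + coords y := rfl

lemma coords_sub (x y : AzimiHaglerSpace 𝕜 w) : coords (x - y) = coords x - coords y := rfl

lemma coords_smul (c : 𝕜) (x : AzimiHaglerSpace 𝕜 w) : coords (c • x) = c • coords x := rfl

lemma coords_injective : Function.Injective (coords (𝕜 := 𝕜) (w := w)) :=
  Subtype.val_injective

lemma bddAbove_chainSums (x : AzimiHaglerSpace 𝕜 w) : BddAbove (chainSums w (coords x)) := x.2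

instance : Norm (AzimiHaglerSpace 𝕜 w) := ⟨fun x => sSup (chainSums w (coords x))⟩

lemma norm_def (x : AzimiHaglerSpace 𝕜 w) : ‖x‖ = sSup (chainSums w (coords x)) := rfl

lemma chainSum_le_norm (x : AzimiHaglerSpace 𝕜 w) {n : ℕ} {F : Fin n → Finset ℕ}
    (hF : IsIntervalChain F) : chainSum w (coords x) F ≤ ‖x‖ :=
  le_csSup (bddAbove_chainSums x) ⟨n, F, hF, rfl⟩

lemma norm_le_of_chainSum_le (x : AzimiHaglerSpace 𝕜 w) {r : ℝ}
    (h : ∀ (n : ℕ) (F : Fin n → Finset ℕ), IsIntervalChain F → chainSum w (coords x) F ≤ r) :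
    ‖x‖ ≤ r :=
  csSup_le (chainSums_nonempty w _) (by rintro _ ⟨n, F, hF, rfl⟩; exact h n F hF)

lemma norm_coords_le (x : AzimiHaglerSpace 𝕜 w) (k : ℕ) : ‖coords x k‖ ≤ ‖x‖ := by
  have hF : IsIntervalChain (fun _ : Fin 1 => ({k} : Finset ℕ)) :=
    ⟨fun _ => ⟨k, k, le_rfl, by simp⟩, fun i j hij => absurd hij (by omega)⟩
  simpa [chainSum, w.first] using chainSum_le_norm x hF

lemma normCore : NormedSpace.Core 𝕜 (AzimiHaglerSpace 𝕜 w) where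
  norm_nonneg x := Real.sSup_nonneg (by rintro _ ⟨n, F, -, rfl⟩; exact chainSum_nonneg w _ F)
  norm_smul c x := by
    have hle : ∀ (c : 𝕜) (x : AzimiHaglerSpace 𝕜 w), ‖c • x‖ ≤ ‖c‖ * ‖x‖ := fun c x =>
      norm_le_of_chainSum_le _ fun n F hF => by
        rw [coords_smul, chainSum_smul]
        exact mul_le_mul_of_nonneg_left (chainSum_le_norm x hF) (norm_nonneg c)
    refine le_antisymm (hle c x) ?_
    rcases eq_or_ne c 0 with rfl | hc
    · rw [norm_zero, zero_mul]
      exact Real.sSup_nonneg (by rintro _ ⟨n, F, -, rfl⟩; exact chainSum_nonneg w _ F)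
    · have h := hle c⁻¹ (c • x)
      rw [inv_smul_smul₀ hc, norm_inv] at h
      exact (le_inv_mul_iff₀ (norm_pos_iff.2 hc)).1 h
  norm_triangle x y := norm_le_of_chainSum_le _ fun n F hF => by
    rw [coords_add]
    exact (chainSum_add_le w _ _ F).trans
      (add_le_add (chainSum_le_norm x hF) (chainSum_le_norm y hF))
  norm_eq_zero_iff x := by
    constructor
    · intro h
      refine coords_injective (funext fun k => ?_)
      exact norm_le_zero_iff.1 (h ▸ norm_coords_le x k)
    · rintro rfl
      refine le_antisymm (norm_le_of_chainSum_le _ fun n F _ => (chainSum_zero w F).le) ?_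
      exact Real.sSup_nonneg (by rintro _ ⟨n, F, -, rfl⟩; exact chainSum_nonneg w _ F)

instance : NormedAddCommGroup (AzimiHaglerSpace 𝕜 w) := NormedAddCommGroup.ofCore normCore

instance : NormedSpace 𝕜 (AzimiHaglerSpace 𝕜 w) := NormedSpace.ofCore normCore

instance : CompleteSpace (AzimiHaglerSpace 𝕜 w) := by
  refine Metric.complete_of_cauchySeq_tendsto fun u hu => ?_
  have hc : ∀ k, CauchySeq fun m => coords (u m) k := by
    intro k
    rw [Metric.cauchySeq_iff'] at hu ⊢
    intro ε hε
    obtain ⟨N, hN⟩ := hu ε hε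
    refine ⟨N, fun m hm => lt_of_le_of_lt ?_ (hN m hm)⟩
    rw [dist_eq_norm, dist_eq_norm]
    exact norm_coords_le (u m - u N) k
  choose x hx using fun k => cauchySeq_tendsto_of_complete (hc k)
  have key : ∀ ε > 0, ∃ N, ∀ m ≥ N, ∀ (n : ℕ) (F : Fin n → Finset ℕ), IsIntervalChain F →
      chainSum w (coords (u m) - x) F ≤ ε := by
    intro ε hε
    obtain ⟨N, hN⟩ := Metric.cauchySeq_iff.1 hu ε hε
    refine ⟨N, fun m hm n F hF => ?_⟩
    have hlim : Tendsto (fun k => chainSum w (coords (u m) - coords (u k)) F) atTop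
        (𝓝 (chainSum w (coords (u m) - x) F)) := by
      unfold chainSum
      refine tendsto_finsetSum _ fun j _ => Tendsto.const_mul _ (Tendsto.norm ?_)
      exact tendsto_finsetSum _ fun s _ => tendsto_const_nhds.sub (hx s)
    refine le_of_tendsto hlim ?_
    filter_upwards [eventually_ge_atTop N] with k hk
    have h := hN m hm k hk
    rw [dist_eq_norm] at h
    exact (chainSum_le_norm (u m - u k) hF).trans h.le
  have hmem : x ∈ submodule 𝕜 w := by
    obtain ⟨N, hN⟩ := key 1 one_pos
    have h1 : coords (u N) - x ∈ submodule 𝕜 w :=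
      ⟨1, by rintro _ ⟨n, F, hF, rfl⟩; exact hN N le_rfl n F hF⟩
    have h2 := (submodule 𝕜 w).sub_mem (u N).2 h1
    have h3 : x = (u N).1 - (coords (u N) - x) := (sub_sub_cancel _ _).symm
    rw [h3]
    exact h2
  let y : AzimiHaglerSpace 𝕜 w := ⟨x, hmem⟩
  refine ⟨y, Metric.tendsto_atTop.2 fun ε hε => ?_⟩
  obtain ⟨N, hN⟩ := key (ε / 2) (half_pos hε)
  refine ⟨N, fun m hm => ?_⟩
  rw [dist_eq_norm]
  exact (norm_le_of_chainSum_le (u m - y) (hN m hm)).trans_lt (half_lt_self hε)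

lemma single_mem (n : ℕ) : (Pi.single n 1 : ℕ → 𝕜) ∈ submodule 𝕜 w := by
  refine ⟨1, ?_⟩
  rintro _ ⟨m, F, hF, rfl⟩
  have hval : ∀ j, ∑ k ∈ F j, (Pi.single n 1 : ℕ → 𝕜) k = if n ∈ F j then 1 else 0 :=
    fun j => Finset.sum_pi_single' n 1 (F j)
  have hw : ∀ j, w.toFun j ≤ 1 := fun j => w.first ▸ w.antitone (Nat.zero_le j)
  unfold chainSum
  by_cases h : ∃ i, n ∈ F i
  · obtain ⟨i, hi⟩ := h
    rw [Finset.sum_eq_single i]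
    · simpa [hval, hi] using hw i
    · intro j _ hji
      have hj : n ∉ F j := fun hj => by
        rcases lt_or_gt_of_ne hji with h | h
        · exact lt_irrefl n (hF.2 j i h n hj n hi)
        · exact lt_irrefl n (hF.2 i j h n hi n hj)
      simp [hval, hj]
    · simp
  · push Not at h
    simp [hval, h]

variable (𝕜 w) in
/-- The coordinate basis of `X(w)`. -/
def e (n : ℕ) : AzimiHaglerSpace 𝕜 w := ⟨Pi.single n 1, single_mem n⟩

variable (𝕜 w) in
/-- The differences of consecutive pairs of basis vectors: with indices counted from `1`,
these are `e_{2n} - e_{2n-1}` for `n = 1, 2, ...`. -/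
def z (n : ℕ) : AzimiHaglerSpace 𝕜 w := e 𝕜 w (2 * n + 1) - e 𝕜 w (2 * n)

end Norm

end AzimiHagler

end

noncomputable section

/-! ### Weak compactness and copies of `ℓ¹`. -/

section WeakTopology

variable {𝕜 : Type*} [RCLike 𝕜] {E F : Type*} [NormedAddCommGroup E] [NormedSpace 𝕜 E]
  [NormedAddCommGroup F] [NormedSpace 𝕜 F]

/-! The vectors `z n` are weakly null, yet suitable normalized block sums of any subsequence span
`ℓ¹`, and an operator close to the identity on the `z n` cannot destroy this.

Weak nullity (`tendsto_apply_z`): sums of `N` of the `z n` with unimodular coefficients have norm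
`o(N)`, because `w` tends to zero and their interval sums stay bounded by 2. A functional that is
large on infinitely many `z n` would make these norms at least proportional to `N`.

Fixing `ℓ¹` (`fixesEllOneCopyIn_of_le_diagonal`): consider the coordinate `2 * a + 1` of `V (z b)`
as a matrix in `a`, `b`. Its diagonal is at least `9 / 10` in modulus. Its rows tend to zero by weak
nullity and its columns because elements of `X(w)` have null coordinates (`tendsto_coords`), so on a
subsequence `v` the off-diagonal part is negligible. Blocks of this subsequence over which the
weight sum at least doubles (`exists_blocks`), divided by that block's weight, are bounded. Testing
`V` of a combination of them against singleton intervals at `2 * v k + 1` recovers the `ℓ¹` norm of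
the coefficients.

Such a `V` is not weakly compact, since the unit vectors of `ℓ¹` have no weak cluster point; hence
both approximation properties fail on the single weakly compact set formed by the `z n` and 0. -/

lemma tendsto_toWeakSpace {α : Type*} {l : Filter α} {u : α → E} {x : E}
    (h : ∀ f : E →L[𝕜] 𝕜, Tendsto (fun n => f (u n)) l (𝓝 (f x))) :
    Tendsto (fun n => toWeakSpace 𝕜 E (u n)) l (𝓝 (toWeakSpace 𝕜 E x)) := by
  have hi : IsInducing fun (y : WeakBilin (topDualPairing 𝕜 E).flip) (f : E →L[𝕜] 𝕜) =>
      (topDualPairing 𝕜 E).flip y f := ⟨rfl⟩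
  exact hi.tendsto_nhds_iff.2 (tendsto_pi_nhds.2 h)

lemma continuous_eval_toWeakSpace_symm (f : E →L[𝕜] 𝕜) :
    Continuous fun y : WeakSpace 𝕜 E => f ((toWeakSpace 𝕜 E).symm y) :=
  WeakBilin.eval_continuous (topDualPairing 𝕜 E).flip f

lemma isWeaklyCompact_range_union_zero {u : ℕ → E}
    (h : ∀ f : E →L[𝕜] 𝕜, Tendsto (fun n => f (u n)) atTop (𝓝 0)) :
    IsWeaklyCompact 𝕜 (Set.range u ∪ {0}) := by
  have h0 : Tendsto (fun n => toWeakSpace 𝕜 E (u n)) atTop (𝓝 (toWeakSpace 𝕜 E 0)) :=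
    tendsto_toWeakSpace fun f => by simpa using h f
  have hc := h0.isCompact_insert_range
  unfold IsWeaklyCompact
  convert hc using 1
  rw [Set.union_singleton, Set.image_insert_eq, ← Set.range_comp]
  rfl

/-- Mazur's theorem: a norm-closed convex set is weakly closed. Scalars are restricted to the reals
so that convexity makes sense. -/
lemma isClosed_image_toWeakSpace {s : Submodule 𝕜 E} (hs : IsClosed (s : Set E)) :
    IsClosed (toWeakSpace 𝕜 E '' (s : Set E)) := by
  let : NormedSpace ℝ E := NormedSpace.restrictScalars ℝ 𝕜 E
  have : IsScalarTower ℝ 𝕜 E := IsScalarTower.restrictScalars ℝ 𝕜 E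
  have hc : Convex ℝ (s : Set E) := (s.restrictScalars ℝ).convex
  have h := hc.toWeakSpace_closure 𝕜
  rw [hs.closure_eq] at h
  rw [h]
  exact isClosed_closure

lemma ellOne_summable_norm (a : lp (fun _ : ℕ => 𝕜) 1) : Summable fun i => ‖a i‖ := by
  simpa using (lp.memℓp a).summable (by simp)

lemma ellOne_norm_eq (a : lp (fun _ : ℕ => 𝕜) 1) : ‖a‖ = ∑' i, ‖a i‖ := by
  simp [lp.norm_eq_tsum_rpow (p := 1) (by simp) a]

/-- Bounded sequences in a Banach space are images of the unit vectors of `ℓ¹`. -/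
lemma exists_ellOne_map [CompleteSpace E] {y : ℕ → E} {C : ℝ} (hy : ∀ i, ‖y i‖ ≤ C) :
    ∃ T : lp (fun _ : ℕ => 𝕜) 1 →L[𝕜] E, (∀ a, ‖T a‖ ≤ C * ‖a‖) ∧ ∀ a, HasSum (fun i => a i • y i) (T a) := by
  have hb : ∀ (a : lp (fun _ : ℕ => 𝕜) 1) i, ‖a i • y i‖ ≤ C * ‖a i‖ := fun a i => by
    rw [norm_smul, mul_comm]
    exact mul_le_mul_of_nonneg_right (hy i) (norm_nonneg _)
  have hs : ∀ a : lp (fun _ : ℕ => 𝕜) 1, Summable fun i => a i • y i := fun a =>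
    Summable.of_norm_bounded ((ellOne_summable_norm a).mul_left C) (hb a)
  have hn : ∀ a : lp (fun _ : ℕ => 𝕜) 1, ‖∑' i, a i • y i‖ ≤ C * ‖a‖ := fun a => by
    rw [ellOne_norm_eq, ← tsum_mul_left]
    exact tsum_of_norm_bounded ((ellOne_summable_norm a).mul_left C).hasSum (hb a)
  let L : lp (fun _ : ℕ => 𝕜) 1 →ₗ[𝕜] E :=
    { toFun := fun a => ∑' i, a i • y i
      map_add' := fun a b => by
        rw [← (hs a).tsum_add (hs b)]
        exact tsum_congr fun i => add_smul _ _ _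
      map_smul' := fun c a => by
        rw [RingHom.id_apply, ← (hs a).tsum_const_smul c]
        exact tsum_congr fun i => mul_smul _ _ _ }
  exact ⟨L.mkContinuous C hn, hn, fun a => (hs a).hasSum⟩

/-- An operator fixing a copy of `ℓ¹` is not weakly compact. -/
lemma FixesEllOneCopyIn.not_isWeaklyCompactOperator [CompleteSpace F] {V : E →L[𝕜] F}
    {M : Submodule 𝕜 E} (h : FixesEllOneCopyIn V M) : ¬ IsWeaklyCompactOperator V := by
  obtain ⟨T, -, c, hc, hT, hVT⟩ := h
  intro hV
  set U : lp (fun _ : ℕ => 𝕜) 1 →L[𝕜] F := V ∘L T with hU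
  have hUb : ∀ a, c * c * ‖a‖ ≤ ‖U a‖ := fun a => by
    rw [mul_assoc]
    exact (mul_le_mul_of_nonneg_left (hT a) hc.le).trans (hVT a)
  have hanti : AntilipschitzWith ⟨(c * c)⁻¹, by positivity⟩ U := U.antilipschitz_of_bound fun a => by
    change ‖a‖ ≤ (c * c)⁻¹ * ‖U a‖
    rw [le_inv_mul_iff₀ (by positivity)]
    exact hUb a
  have hclo : IsClosed (Set.range U) := hanti.isClosed_range U.uniformContinuous
  let S := (U.equivRange hanti.injective hclo).symm
  have hS : ∀ a, S ⟨U a, a, rfl⟩ = a := fun a => U.equivRange_symm_apply _ _ a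
  -- Since `U` is an isomorphism onto its closed range, Hahn–Banach extends every functional on
  -- `ℓ¹`, transported by `U`, to all of `F`.
  have hext : ∀ φ : lp (fun _ : ℕ => 𝕜) 1 →L[𝕜] 𝕜, ∃ g : F →L[𝕜] 𝕜, ∀ a, g (U a) = φ a := fun φ => by
    obtain ⟨g, hg, -⟩ := exists_extension_norm_eq U.range (φ ∘L (S : U.range →L[𝕜] lp (fun _ : ℕ => 𝕜) 1))
    refine ⟨g, fun a => ?_⟩
    rw [hg ⟨U a, a, rfl⟩]
    exact congrArg φ (hS a)
  -- Scaling the unit vectors by this factor puts their images under `T` in the closed unit ball.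
  set r : 𝕜 := ((‖T‖ + 1 : ℝ) : 𝕜)⁻¹ with hr
  have hr0 : r ≠ 0 := by
    rw [hr]
    exact inv_ne_zero (RCLike.ofReal_ne_zero.2 (by positivity))
  let b : ℕ → lp (fun _ : ℕ => 𝕜) 1 := fun i => lp.single 1 i r
  have hbval : ∀ i j, b i j = if j = i then r else 0 := fun i j => by
    simp [b, Pi.single_apply]
  have hbn : ∀ i, ‖T (b i)‖ ≤ 1 := fun i => by
    refine (T.le_opNorm _).trans ?_
    rw [lp.norm_single (by simp), hr, norm_inv, RCLike.norm_ofReal, abs_of_pos (by positivity),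
      ← div_eq_mul_inv, div_le_one (by positivity)]
    linarith
  have hmem : ∀ i, toWeakSpace 𝕜 F (U (b i)) ∈
      closure (toWeakSpace 𝕜 F '' (V '' Metric.closedBall (0 : E) 1)) := fun i =>
    subset_closure ⟨_, ⟨T (b i), by simpa using hbn i, rfl⟩, rfl⟩
  -- A weak cluster point lies in the weakly closed range, so it is some `U a`. Coordinate
  -- functionals force `a = 0`, while the summation functional `σ` takes the value `r ≠ 0` at every
  -- `b i`, hence at `a`.
  obtain ⟨y, -, hy⟩ := IsCompact.exists_mapClusterPt hV (f := atTop)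
    (u := fun i => toWeakSpace 𝕜 F (U (b i))) (tendsto_principal.2 (Eventually.of_forall hmem))
  have hyr : y ∈ toWeakSpace 𝕜 F '' (U.range : Set F) :=
    (isClosed_image_toWeakSpace (s := U.range) hclo).mem_of_mapClusterPt hy
      (Eventually.of_forall fun i => ⟨U (b i), ⟨b i, rfl⟩, rfl⟩)
  obtain ⟨_, ⟨a, rfl⟩, rfl⟩ := hyr
  have hlim : ∀ (φ : lp (fun _ : ℕ => 𝕜) 1 →L[𝕜] 𝕜) (l : 𝕜), Tendsto (fun i => φ (b i)) atTop (𝓝 l) →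
      φ a = l := fun φ l hl => by
    obtain ⟨g, hg⟩ := hext φ
    have h1 := hy.continuousAt_comp (continuous_eval_toWeakSpace_symm g).continuousAt
    have h2 : Tendsto ((fun y : WeakSpace 𝕜 F => g ((toWeakSpace 𝕜 F).symm y)) ∘
        fun i => toWeakSpace 𝕜 F (U (b i))) atTop (𝓝 l) := by
      refine hl.congr fun i => ?_
      simp only [Function.comp, LinearEquiv.symm_apply_apply, hg]
    have h3 : g (U a) = l := by
      have h4 := h1.clusterPt.mono h2
      exact eq_of_nhds_neBot h4
    rw [← hg a, h3]
  have ha : a = 0 := by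
    ext j
    refine hlim (lp.evalCLM 𝕜 (fun _ : ℕ => 𝕜) 1 j) 0 (tendsto_const_nhds.congr' ?_)
    filter_upwards [eventually_gt_atTop j] with i hi
    change (0 : 𝕜) = b i j
    rw [hbval, if_neg hi.ne]
  obtain ⟨σ, -, hσ⟩ := exists_ellOne_map (𝕜 := 𝕜) (y := fun _ : ℕ => (1 : 𝕜)) (C := 1) (by simp)
  have hσb : ∀ i, σ (b i) = r := fun i => by
    refine (hσ (b i)).unique ?_
    simpa only [hbval, smul_eq_mul, mul_one] using hasSum_ite_eq i r
  have h1 := hlim σ r (tendsto_const_nhds.congr fun i => (hσb i).symm)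
  rw [ha, map_zero] at h1
  exact hr0 h1.symm

end WeakTopology

end

noncomputable section

namespace AzimiHagler

/-! ### Norm estimates, weak nullity of `z`, and null coordinates. -/

section Space

variable {𝕜 : Type*} [RCLike 𝕜] {w : AzimiHaglerWeight}

lemma coords_sum_apply {ι : Type*} (s : Finset ι) (f : ι → AzimiHaglerSpace 𝕜 w) (k : ℕ) :
    coords (∑ i ∈ s, f i) k = ∑ i ∈ s, coords (f i) k := by
  classical
  induction s using Finset.induction_on with
  | empty => rfl
  | insert a s ha ih => rw [Finset.sum_insert ha, Finset.sum_insert ha, ← ih]; rfl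

variable (𝕜 w) in
/-- The coordinate functionals of `X(w)`. -/
def coordCLM (k : ℕ) : AzimiHaglerSpace 𝕜 w →L[𝕜] 𝕜 :=
  LinearMap.mkContinuous
    { toFun := fun x => coords x k
      map_add' := fun _ _ => rfl
      map_smul' := fun _ _ => rfl } 1 fun x => by
    rw [one_mul]
    exact norm_coords_le x k

lemma coords_z (n k : ℕ) : coords (z 𝕜 w n) k =
    (if k = 2 * n + 1 then 1 else 0) - (if k = 2 * n then 1 else 0) := by
  change (Pi.single (2 * n + 1) 1 : ℕ → 𝕜) k - (Pi.single (2 * n) 1 : ℕ → 𝕜) k = _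
  rw [Pi.single_apply, Pi.single_apply]

lemma coords_z_self (n : ℕ) : coords (z 𝕜 w n) (2 * n + 1) = 1 := by
  simp [coords_z]

/-- An initial segment sees a nonzero sum only when it cuts between the two support points. For
different `n` the cuts differ, so partial sums of combinations never accumulate. -/
lemma sum_range_coords_z (n m : ℕ) : ∑ k ∈ Finset.range m, coords (z 𝕜 w n) k =
    if m = 2 * n + 1 then -1 else 0 := by
  simp only [coords_z, Finset.sum_sub_distrib, Finset.sum_ite_eq', Finset.mem_range]
  split_ifs <;> first | omega | simp

lemma sum_norm_coords_z_le (n : ℕ) (s : Finset ℕ) : ∑ k ∈ s, ‖coords (z 𝕜 w n) k‖ ≤ 2 := by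
  calc ∑ k ∈ s, ‖coords (z 𝕜 w n) k‖
      ≤ ∑ k ∈ s, ((if k = 2 * n + 1 then 1 else 0) + (if k = 2 * n then 1 else 0) : ℝ) := by
        refine Finset.sum_le_sum fun k _ => ?_
        rw [coords_z]
        refine (norm_sub_le _ _).trans (add_le_add ?_ ?_) <;> split_ifs <;> simp
    _ ≤ 2 := by
        rw [Finset.sum_add_distrib, Finset.sum_ite_eq', Finset.sum_ite_eq']
        split_ifs <;> norm_num

lemma sum_chain_norm_le {x : ℕ → 𝕜} {C : ℝ} (hx : ∀ s : Finset ℕ, ∑ k ∈ s, ‖x k‖ ≤ C)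
    {n : ℕ} {F : Fin n → Finset ℕ} (hF : IsIntervalChain F) :
    ∑ j, ‖∑ k ∈ F j, x k‖ ≤ C := by
  have hd : Set.PairwiseDisjoint ((Finset.univ : Finset (Fin n)) : Set (Fin n)) F := by
    intro i _ j _ hij
    refine Finset.disjoint_left.2 fun k hi hj => ?_
    rcases lt_or_gt_of_ne hij with h | h
    · exact lt_irrefl k (hF.2 i j h k hi k hj)
    · exact lt_irrefl k (hF.2 j i h k hj k hi)
  calc ∑ j, ‖∑ k ∈ F j, x k‖ ≤ ∑ j, ∑ k ∈ F j, ‖x k‖ :=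
        Finset.sum_le_sum fun j _ => norm_sum_le _ _
    _ = ∑ k ∈ Finset.univ.biUnion F, ‖x k‖ := (Finset.sum_biUnion hd).symm
    _ ≤ C := hx _

lemma norm_sum_interval_le {x : ℕ → 𝕜} {C : ℝ}
    (hx : ∀ m, ‖∑ k ∈ Finset.range m, x k‖ ≤ C) {a b : ℕ} (hab : a ≤ b) :
    ‖∑ k ∈ Finset.Icc a b, x k‖ ≤ 2 * C := by
  have h : ∑ k ∈ Finset.Icc a b, x k =
      ∑ k ∈ Finset.range (b + 1), x k - ∑ k ∈ Finset.range a, x k := by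
    rw [← Finset.sum_Ico_eq_sub _ (by omega)]
    rfl
  rw [h, two_mul]
  exact (norm_sub_le _ _).trans (add_le_add (hx _) (hx _))

/-- The norm of a combination of `N` of the `z n` with coefficients of modulus at most `1` is of
the order of the sum of the first `N` weights. -/
lemma norm_sum_smul_z_le (A : Finset ℕ) {θ : ℕ → 𝕜} (hθ : ∀ n, ‖θ n‖ ≤ 1) (M : ℕ) :
    ‖∑ n ∈ A, θ n • z 𝕜 w n‖ ≤
      2 * ∑ j ∈ Finset.range M, w.toFun j + w.toFun M * (2 * A.card) := by
  have hval : ∀ k, coords (∑ n ∈ A, θ n • z 𝕜 w n) k = ∑ n ∈ A, θ n * coords (z 𝕜 w n) k :=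
    fun k => coords_sum_apply _ _ _
  set x := ∑ n ∈ A, θ n • z 𝕜 w n
  have hpart : ∀ m, ‖∑ k ∈ Finset.range m, coords x k‖ ≤ 1 := by
    intro m
    simp only [hval]
    rw [Finset.sum_comm]
    simp only [← Finset.mul_sum, sum_range_coords_z]
    by_cases hm : ∃ i ∈ A, m = 2 * i + 1
    · obtain ⟨i, hi, rfl⟩ := hm
      rw [Finset.sum_eq_single_of_mem i hi]
      · simpa using hθ i
      · intro j _ hj
        rw [if_neg (by omega), mul_zero]
    · rw [Finset.sum_eq_zero]
      · simp
      · intro i hi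
        rw [if_neg fun h => hm ⟨i, hi, h⟩, mul_zero]
  have htot : ∀ s : Finset ℕ, ∑ k ∈ s, ‖coords x k‖ ≤ 2 * A.card := by
    intro s
    calc ∑ k ∈ s, ‖coords x k‖ ≤ ∑ k ∈ s, ∑ n ∈ A, ‖coords (z 𝕜 w n) k‖ := by
          refine Finset.sum_le_sum fun k _ => ?_
          rw [hval]
          refine (norm_sum_le _ _).trans (Finset.sum_le_sum fun n _ => ?_)
          rw [norm_mul]
          exact mul_le_of_le_one_left (norm_nonneg _) (hθ n)
      _ = ∑ n ∈ A, ∑ k ∈ s, ‖coords (z 𝕜 w n) k‖ := Finset.sum_comm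
      _ ≤ ∑ n ∈ A, (2 : ℝ) := Finset.sum_le_sum fun n _ => sum_norm_coords_z_le n s
      _ = 2 * A.card := by rw [Finset.sum_const, nsmul_eq_mul, mul_comm]
  refine norm_le_of_chainSum_le _ fun n F hF => ?_
  have hs2 : ∀ j, ‖∑ k ∈ F j, coords x k‖ ≤ 2 := fun j => by
    obtain ⟨a, b, hab, hj⟩ := hF.1 j
    rw [hj]
    simpa using norm_sum_interval_le hpart hab
  -- The first `M` intervals are charged the uniform bound 2, the later ones the weight `w M` times
  -- the total `ℓ¹` mass.
  calc chainSum w (coords x) F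
      ≤ ∑ j : Fin n, ((if (j : ℕ) < M then 2 * w.toFun j else 0) +
          w.toFun M * ‖∑ k ∈ F j, coords x k‖) := by
        refine Finset.sum_le_sum fun j _ => ?_
        have h0 := norm_nonneg (∑ k ∈ F j, coords x k)
        split_ifs with hj
        · nlinarith [hs2 j, (w.pos j).le, mul_nonneg (w.pos M).le h0]
        · rw [zero_add]
          exact mul_le_mul_of_nonneg_right (w.antitone (not_lt.1 hj)) h0
    _ ≤ _ := by
        rw [Finset.sum_add_distrib, ← Finset.mul_sum]
        refine add_le_add ?_
          (mul_le_mul_of_nonneg_left (sum_chain_norm_le htot hF) (w.pos M).le)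
        rw [Fin.sum_univ_eq_sum_range (fun j => if j < M then 2 * w.toFun j else 0),
          ← Finset.sum_filter, Finset.mul_sum]
        refine Finset.sum_le_sum_of_subset_of_nonneg (fun j hj => ?_)
          fun j _ _ => mul_nonneg zero_le_two (w.pos j).le
        exact Finset.mem_range.2 (Finset.mem_filter.1 hj).2

/-- If the values do not tend to zero, rotating `N` large ones to be positive gives `N * ε ≤ ‖f‖ *
(2 * W + 2 * N * w M)` with `W` the sum of the first `M` weights. Fixing `M` with `w M` small and
then taking `N` large is contradictory. -/
lemma tendsto_apply_z (f : AzimiHaglerSpace 𝕜 w →L[𝕜] 𝕜) :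
    Tendsto (fun n => f (z 𝕜 w n)) atTop (𝓝 0) := by
  by_contra hcon
  obtain ⟨ε, hε, hfr⟩ : ∃ ε > 0, ∃ᶠ n in atTop, ε ≤ ‖f (z 𝕜 w n)‖ := by
    rw [Metric.tendsto_nhds] at hcon
    push Not at hcon
    obtain ⟨ε, hε, h⟩ := hcon
    refine ⟨ε, hε, ?_⟩
    simpa [Filter.not_eventually] using h
  have hinf := Nat.frequently_atTop_iff_infinite.1 hfr
  choose θ hθ1 hθ using fun n => RCLike.exists_norm_eq_mul_self (f (z 𝕜 w n))
  have key : ∀ M N : ℕ, N * ε ≤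
      ‖f‖ * (2 * ∑ j ∈ Finset.range M, w.toFun j + w.toFun M * (2 * N)) := by
    intro M N
    obtain ⟨A, hA, hcard⟩ := hinf.exists_subset_card_eq N
    have h1 := norm_sum_smul_z_le (w := w) A (fun n => (hθ1 n).le) M
    have h2 : f (∑ n ∈ A, θ n • z 𝕜 w n) = ((∑ n ∈ A, ‖f (z 𝕜 w n)‖ : ℝ) : 𝕜) := by
      rw [map_sum, RCLike.ofReal_sum]
      refine Finset.sum_congr rfl fun n _ => ?_
      rw [map_smul, smul_eq_mul]
      exact (hθ n).symm
    have h3 : N * ε ≤ ∑ n ∈ A, ‖f (z 𝕜 w n)‖ := by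
      rw [← hcard, ← nsmul_eq_mul]
      exact Finset.card_nsmul_le_sum _ _ _ fun n hn => hA hn
    have h4 := f.le_opNorm (∑ n ∈ A, θ n • z 𝕜 w n)
    rw [h2, RCLike.norm_ofReal] at h4
    rw [hcard] at h1
    exact h3.trans ((le_abs_self _).trans
      (h4.trans (mul_le_mul_of_nonneg_left h1 (norm_nonneg f))))
  obtain ⟨M, hM⟩ : ∃ M, ‖f‖ * 2 * w.toFun M < ε / 2 := by
    have h := w.tendsto_zero.const_mul (‖f‖ * 2)
    rw [mul_zero] at h
    exact (h.eventually_lt_const (half_pos hε)).exists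
  obtain ⟨N, hN⟩ := exists_nat_gt ((‖f‖ * (2 * ∑ j ∈ Finset.range M, w.toFun j)) / (ε / 2))
  rw [div_lt_iff₀ (half_pos hε)] at hN
  have h1 := key M N
  have h2 : ‖f‖ * 2 * w.toFun M * N ≤ ε / 2 * N :=
    mul_le_mul_of_nonneg_right hM.le (Nat.cast_nonneg N)
  nlinarith

lemma sum_mul_norm_coords_le (x : AzimiHaglerSpace 𝕜 w) {p : ℕ → ℕ} (hp : StrictMono p) (n : ℕ) :
    ∑ k ∈ Finset.range n, w.toFun k * ‖coords x (p k)‖ ≤ ‖x‖ := by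
  have hF : IsIntervalChain (fun j : Fin n => ({p j} : Finset ℕ)) := by
    refine ⟨fun j => ⟨p j, p j, le_rfl, by simp⟩, fun i j hij s hs t ht => ?_⟩
    rw [Finset.mem_singleton.1 hs, Finset.mem_singleton.1 ht]
    exact hp hij
  have h := chainSum_le_norm x hF
  simp only [chainSum, Finset.sum_singleton] at h
  rwa [Fin.sum_univ_eq_sum_range (fun k => w.toFun k * ‖coords x (p k)‖)] at h

/-- Infinitely many coordinates of modulus at least `ε`, tested by singleton intervals, would bound
the divergent weight sum by `‖x‖ / ε`. -/
lemma tendsto_coords (x : AzimiHaglerSpace 𝕜 w) : Tendsto (coords x) atTop (𝓝 0) := by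
  by_contra hcon
  obtain ⟨ε, hε, hfr⟩ : ∃ ε > 0, ∃ᶠ n in atTop, ε ≤ ‖coords x n‖ := by
    rw [Metric.tendsto_nhds] at hcon
    push Not at hcon
    obtain ⟨ε, hε, h⟩ := hcon
    exact ⟨ε, hε, by simpa [Filter.not_eventually] using h⟩
  obtain ⟨p, hp, hpε⟩ := extraction_of_frequently_atTop hfr
  obtain ⟨n, hn⟩ := (w.tendsto_sum.eventually_gt_atTop (‖x‖ / ε)).exists
  rw [div_lt_iff₀ hε, Finset.sum_mul] at hn
  exact absurd (sum_mul_norm_coords_le x hp n) (not_le.2 (hn.trans_le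
    (Finset.sum_le_sum fun k _ => mul_le_mul_of_nonneg_left (hpε k) (w.pos k).le)))

/-- A matrix whose rows and columns tend to zero has a principal submatrix with very small
off-diagonal entries. -/
lemma exists_strictMono_offDiagonal_le {m : ℕ → ℕ → 𝕜}
    (hrow : ∀ a, Tendsto (fun b => m a b) atTop (𝓝 0))
    (hcol : ∀ b, Tendsto (fun a => m a b) atTop (𝓝 0)) {c : ℝ} (hc : 0 < c) :
    ∃ v : ℕ → ℕ, StrictMono v ∧
      ∀ k l, k ≠ l → ‖m (v k) (v l)‖ ≤ c * (1 / 2) ^ k * (1 / 2) ^ l := by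
  have hsmall : ∀ {u : ℕ → 𝕜}, Tendsto u atTop (𝓝 0) → ∀ δ > 0, ∀ᶠ n in atTop, ‖u n‖ ≤ δ := by
    intro u hu δ hδ
    filter_upwards [(Metric.tendsto_nhds.1 hu) δ hδ] with n hn
    simpa using hn.le
  -- The first component is a strictly increasing stage counter: the recursion sees only the set of
  -- earlier values, yet the required smallness depends on the stage.
  obtain ⟨f, -, hf⟩ := exists_seq_of_forall_finset_exists (α := ℕ × ℕ) (fun _ => True)
    (fun x y => x.1 < y.1 ∧ x.2 < y.2 ∧
      ‖m x.2 y.2‖ ≤ c * (1 / 2) ^ x.1 * (1 / 2) ^ y.1 ∧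
      ‖m y.2 x.2‖ ≤ c * (1 / 2) ^ x.1 * (1 / 2) ^ y.1) (by
    intro s _
    obtain ⟨t, ht⟩ : ∃ t : ℕ, ∀ x ∈ s, x.1 < t := by
      refine ⟨s.sup Prod.fst + 1, fun x hx => Nat.lt_succ_of_le ?_⟩
      exact Finset.le_sup (f := Prod.fst) hx
    have hev : ∀ᶠ b in atTop, ∀ x ∈ s, x.2 < b ∧
        ‖m x.2 b‖ ≤ c * (1 / 2) ^ x.1 * (1 / 2) ^ t ∧
        ‖m b x.2‖ ≤ c * (1 / 2) ^ x.1 * (1 / 2) ^ t := by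
      refine (Finset.eventually_all s).2 fun x _ => ?_
      exact (eventually_gt_atTop x.2).and ((hsmall (hrow x.2) _ (by positivity)).and
        (hsmall (hcol x.2) _ (by positivity)))
    obtain ⟨b, hb⟩ := hev.exists
    exact ⟨(t, b), trivial, fun x hx => ⟨ht x hx, hb x hx⟩⟩)
  have hmono : StrictMono fun k => (f k).1 := fun k l hkl => (hf k l hkl).1
  have hpow : ∀ k, (1 / 2 : ℝ) ^ (f k).1 ≤ (1 / 2) ^ k := fun k =>
    pow_le_pow_of_le_one (by norm_num) (by norm_num) (hmono.id_le k)
  have hle : ∀ k l, c * (1 / 2 : ℝ) ^ (f k).1 * (1 / 2) ^ (f l).1 ≤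
      c * (1 / 2) ^ k * (1 / 2) ^ l := fun k l => by
    have h1 := hpow k
    have h2 := hpow l
    gcongr
  refine ⟨fun k => (f k).2, fun k l hkl => (hf k l hkl).2.1, fun k l hkl => ?_⟩
  rcases lt_or_gt_of_ne hkl with h | h
  · exact (hf k l h).2.2.1.trans (hle k l)
  · refine (hf l k h).2.2.2.trans ((hle l k).trans_eq (by ring))

end Space

end AzimiHagler

end

noncomputable section

namespace AzimiHagler

/-! ### Block sums and the fixed copy of `ℓ¹`. -/

section Blocks

variable {𝕜 : Type*} [RCLike 𝕜] {w : AzimiHaglerWeight}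

variable (w) in
-- Doubling makes the weight of each block at least half of the whole sum up to its end; the summand
-- 2 makes it at least 1.
lemma exists_blocks : ∃ s : ℕ → ℕ, s 0 = 0 ∧ StrictMono s ∧
    ∀ i, 2 * ∑ k ∈ Finset.range (s i), w.toFun k + 2 ≤ ∑ k ∈ Finset.range (s (i + 1)), w.toFun k := by
  have h : ∀ n : ℕ, ∃ m, n < m ∧
      2 * ∑ k ∈ Finset.range n, w.toFun k + 2 ≤ ∑ k ∈ Finset.range m, w.toFun k := fun n =>
    ((eventually_gt_atTop n).and (w.tendsto_sum.eventually_ge_atTop _)).exists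
  choose g hg1 hg2 using h
  exact ⟨fun i => Nat.rec 0 (fun _ n => g n) i, rfl, strictMono_nat_of_lt_succ fun i => hg1 _,
    fun i => hg2 _⟩

lemma sum_range_sum_Ico {s : ℕ → ℕ} (h0 : s 0 = 0) (hs : StrictMono s) (f : ℕ → ℝ) (n : ℕ) :
    ∑ i ∈ Finset.range n, ∑ k ∈ Finset.Ico (s i) (s (i + 1)), f k =
      ∑ k ∈ Finset.range (s n), f k := by
  induction n with
  | zero => simp [h0]
  | succ n ih =>
    rw [Finset.sum_range_succ, ih, Finset.sum_range_add_sum_Ico _ (hs.monotone n.le_succ)]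

lemma mul_le_sum_range (M : ℕ) : M * w.toFun M ≤ ∑ j ∈ Finset.range M, w.toFun j := by
  have h := Finset.card_nsmul_le_sum (Finset.range M) w.toFun (w.toFun M)
    fun j hj => w.antitone (Finset.mem_range.1 hj).le
  simpa using h

/-- Take cutoff `M = b` in `norm_sum_smul_z_le`; monotonicity gives `b * w b` at most the sum of the
first `b` weights. -/
lemma norm_sum_z_le {v : ℕ → ℕ} (hv : StrictMono v) (a b : ℕ) :
    ‖∑ k ∈ Finset.Ico a b, z 𝕜 w (v k)‖ ≤ 4 * ∑ k ∈ Finset.range b, w.toFun k := by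
  have h1 := norm_sum_smul_z_le (w := w) ((Finset.Ico a b).image v) (θ := fun _ => (1 : 𝕜))
    (by simp) b
  rw [Finset.sum_image hv.injective.injOn, Finset.card_image_of_injective _ hv.injective,
    Nat.card_Ico] at h1
  simp only [one_smul] at h1
  have h2 := mul_le_sum_range (w := w) b
  have h3 : ((b - a : ℕ) : ℝ) ≤ b := Nat.cast_le.2 (Nat.sub_le b a)
  have h4 := mul_le_mul_of_nonneg_left h3 (w.pos b).le
  linarith

/-- An operator whose matrix with respect to `z` has diagonal bounded away from zero fixes a copy of
`ℓ¹` spanned by normalized block sums of a subsequence of `z`. -/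
lemma fixesEllOneCopyIn_of_le_diagonal (V : AzimiHaglerSpace 𝕜 w →L[𝕜] AzimiHaglerSpace 𝕜 w)
    (hV : ∀ n, 9 / 10 ≤ ‖coords (V (z 𝕜 w n)) (2 * n + 1)‖) :
    FixesEllOneCopyIn V (Submodule.span 𝕜 (Set.range (z 𝕜 w))).topologicalClosure := by
  obtain ⟨v, hv, hoff⟩ := exists_strictMono_offDiagonal_le
    (m := fun a b => coords (V (z 𝕜 w b)) (2 * a + 1))
    (fun a => tendsto_apply_z (coordCLM 𝕜 w (2 * a + 1) ∘L V))
    (fun b => (tendsto_coords (V (z 𝕜 w b))).comp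
      (tendsto_atTop_mono (fun a => show a ≤ 2 * a + 1 by omega) tendsto_id)) (c := 1 / 16) (by norm_num)
  obtain ⟨s, hs0, hs, hsW⟩ := exists_blocks w
  set G : ℕ → AzimiHaglerSpace 𝕜 w →L[𝕜] 𝕜 := fun k => coordCLM 𝕜 w (2 * v k + 1) ∘L V with hG
  have hdiag : ∀ k, 9 / 10 ≤ ‖G k (z 𝕜 w (v k))‖ := fun k => hV (v k)
  have hGoff : ∀ (k : ℕ) (t : Finset ℕ), k ∉ t →
      ‖∑ l ∈ t, G k (z 𝕜 w (v l))‖ ≤ 1 / 8 * (1 / 2) ^ k := by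
    intro k t hk
    calc ‖∑ l ∈ t, G k (z 𝕜 w (v l))‖
        ≤ ∑ l ∈ t, 1 / 16 * (1 / 2 : ℝ) ^ k * (1 / 2) ^ l :=
          norm_sum_le_of_le _ fun l hl => hoff k l fun h => hk (h ▸ hl)
      _ = 1 / 16 * (1 / 2 : ℝ) ^ k * ∑ l ∈ t, (1 / 2 : ℝ) ^ l := (Finset.mul_sum _ _ _).symm
      _ ≤ 1 / 16 * (1 / 2 : ℝ) ^ k * 2 := by
          refine mul_le_mul_of_nonneg_left ?_ (by positivity)
          exact sum_le_hasSum t (fun _ _ => by positivity) hasSum_geometric_two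
      _ = 1 / 8 * (1 / 2) ^ k := by ring
  set D : ℕ → ℝ := fun i => ∑ k ∈ Finset.Ico (s i) (s (i + 1)), w.toFun k with hD
  have hDW : ∀ i, ∑ k ∈ Finset.range (s i), w.toFun k + D i =
      ∑ k ∈ Finset.range (s (i + 1)), w.toFun k := fun i =>
    Finset.sum_range_add_sum_Ico _ (hs.monotone i.le_succ)
  have hW0 : ∀ n, 0 ≤ ∑ k ∈ Finset.range n, w.toFun k := fun n =>
    Finset.sum_nonneg fun k _ => (w.pos k).le
  have hD1 : ∀ i, 1 ≤ D i := fun i => by linarith [hDW i, hsW i, hW0 (s i)]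
  have hD0 : ∀ i, 0 < D i := fun i => one_pos.trans_le (hD1 i)
  have hDn : ∀ i, ‖((D i : ℝ) : 𝕜)⁻¹‖ = (D i)⁻¹ := fun i => by
    rw [norm_inv, RCLike.norm_ofReal, abs_of_pos (hD0 i)]
  let y : ℕ → AzimiHaglerSpace 𝕜 w := fun i =>
    ((D i : ℝ) : 𝕜)⁻¹ • ∑ k ∈ Finset.Ico (s i) (s (i + 1)), z 𝕜 w (v k)
  have hy : ∀ i, ‖y i‖ ≤ 8 := fun i => by
    rw [norm_smul, hDn, inv_mul_le_iff₀ (hD0 i)]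
    refine (norm_sum_z_le hv _ _).trans ?_
    linarith [hDW i, hsW i]
  obtain ⟨T, hTb, hT⟩ := exists_ellOne_map (𝕜 := 𝕜) hy
  have hdisj : ∀ i j k, k ∈ Finset.Ico (s i) (s (i + 1)) → j ≠ i →
      k ∉ Finset.Ico (s j) (s (j + 1)) := by
    intro i j k hk hij hk'
    rw [Finset.mem_Ico] at hk hk'
    rcases lt_or_gt_of_ne hij with h | h
    · have := hs.monotone (Nat.succ_le_of_lt h)
      simp only [Nat.succ_eq_add_one] at this
      omega
    · have := hs.monotone (Nat.succ_le_of_lt h)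
      simp only [Nat.succ_eq_add_one] at this
      omega
  -- The bound does not depend on `j`, since `D j ≥ 1`; it therefore sums against any `ℓ¹`
  -- coefficients.
  have herr : ∀ i j k, k ∈ Finset.Ico (s i) (s (i + 1)) →
      ‖G k (y j) - if j = i then ((D i : ℝ) : 𝕜)⁻¹ * G k (z 𝕜 w (v k)) else 0‖ ≤
        1 / 8 * (1 / 2) ^ k := by
    intro i j k hk
    have hform : G k (y j) - (if j = i then ((D i : ℝ) : 𝕜)⁻¹ * G k (z 𝕜 w (v k)) else 0) =
        ((D j : ℝ) : 𝕜)⁻¹ *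
          ∑ l ∈ (Finset.Ico (s j) (s (j + 1))).erase k, G k (z 𝕜 w (v l)) := by
      have h1 : G k (y j) = ((D j : ℝ) : 𝕜)⁻¹ *
          ∑ l ∈ Finset.Ico (s j) (s (j + 1)), G k (z 𝕜 w (v l)) := by
        rw [← map_sum]
        exact map_smul (G k) _ _
      rw [h1]
      split_ifs with hji
      · subst hji
        rw [← mul_sub, ← Finset.sum_erase_eq_sub hk]
      · rw [Finset.erase_eq_of_notMem (hdisj i j k hk hji), sub_zero]
    rw [hform, norm_mul, hDn]
    refine (mul_le_of_le_one_left (norm_nonneg _) (inv_le_one_of_one_le₀ (hD1 j))).trans ?_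
    exact hGoff k _ (Finset.notMem_erase k _)
  have hlow : ∀ a i k, k ∈ Finset.Ico (s i) (s (i + 1)) →
      9 / 10 * ‖a i‖ * (D i)⁻¹ - 1 / 8 * (1 / 2) ^ k * ‖a‖ ≤ ‖G k (T a)‖ := by
    intro a i k hk
    set α : 𝕜 := ((D i : ℝ) : 𝕜)⁻¹ * G k (z 𝕜 w (v k)) with hα
    have hαn : 9 / 10 * (D i)⁻¹ ≤ ‖α‖ := by
      rw [hα, norm_mul, hDn, mul_comm]
      exact mul_le_mul_of_nonneg_left (hdiag k) (inv_nonneg.2 (hD0 i).le)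
    have h1 : HasSum (fun j => a j * G k (y j)) (G k (T a)) := by
      simpa [Function.comp_def] using (G k).hasSum (hT a)
    have h2 : HasSum (fun j => a j * (if j = i then α else 0)) (a i * α) := by
      convert hasSum_ite_eq i (a i * α) using 2 with j
      split_ifs with h
      · rw [h]
      · rw [mul_zero]
    have h3 : ‖G k (T a) - a i * α‖ ≤ 1 / 8 * (1 / 2) ^ k * ‖a‖ := by
      rw [← (h1.sub h2).tsum_eq, ellOne_norm_eq, ← tsum_mul_left]
      refine tsum_of_norm_bounded ((ellOne_summable_norm a).mul_left _).hasSum fun j => ?_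
      rw [← mul_sub, norm_mul, mul_comm]
      exact mul_le_mul_of_nonneg_right (herr i j k hk) (norm_nonneg _)
    have h4 : ‖a i * α‖ ≤ ‖G k (T a)‖ + ‖G k (T a) - a i * α‖ := by
      have := norm_sub_le (G k (T a)) (G k (T a) - a i * α)
      rwa [sub_sub_cancel] at this
    have h5 : 9 / 10 * ‖a i‖ * (D i)⁻¹ ≤ ‖a i * α‖ := by
      rw [norm_mul]
      calc 9 / 10 * ‖a i‖ * (D i)⁻¹ = ‖a i‖ * (9 / 10 * (D i)⁻¹) := by ring
        _ ≤ _ := mul_le_mul_of_nonneg_left hαn (norm_nonneg _)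
    linarith
  -- The weights of block `i` add up to `D i`, which cancels the normalization and leaves `9 / 10 *
  -- ‖a i‖`. All errors together cost at most `1 / 4 * ‖a‖`.
  have hVT : ∀ a, 1 / 2 * ‖a‖ ≤ ‖V (T a)‖ := by
    intro a
    have hpart : ∀ n, ∑ i ∈ Finset.range n, ‖a i‖ ≤ 10 / 9 * (‖V (T a)‖ + 1 / 4 * ‖a‖) := by
      intro n
      have h1 : ∑ k ∈ Finset.range (s n), w.toFun k * ‖G k (T a)‖ ≤ ‖V (T a)‖ :=
        sum_mul_norm_coords_le (V (T a)) (p := fun k => 2 * v k + 1)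
          (fun k l h => by have := hv h; dsimp only; omega) (s n)
      have h2 : ∑ i ∈ Finset.range n, (9 / 10 * ‖a i‖ -
          ∑ k ∈ Finset.Ico (s i) (s (i + 1)), 1 / 8 * (1 / 2) ^ k * ‖a‖) ≤
          ∑ k ∈ Finset.range (s n), w.toFun k * ‖G k (T a)‖ := by
        rw [← sum_range_sum_Ico hs0 hs]
        refine Finset.sum_le_sum fun i _ => ?_
        have h3 : 9 / 10 * ‖a i‖ = ∑ k ∈ Finset.Ico (s i) (s (i + 1)),
            w.toFun k * (9 / 10 * ‖a i‖ * (D i)⁻¹) := by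
          rw [← Finset.sum_mul]
          change _ = D i * _
          rw [mul_comm (D i), mul_assoc, inv_mul_cancel₀ (hD0 i).ne', mul_one]
        rw [h3, ← Finset.sum_sub_distrib]
        refine Finset.sum_le_sum fun k hk => ?_
        have h4 := mul_le_mul_of_nonneg_left (hlow a i k hk) (w.pos k).le
        rw [mul_sub] at h4
        have h5 : w.toFun k * (1 / 8 * (1 / 2) ^ k * ‖a‖) ≤ 1 / 8 * (1 / 2) ^ k * ‖a‖ :=
          mul_le_of_le_one_left (by positivity) (w.first ▸ w.antitone (Nat.zero_le k))
        linarith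
      rw [Finset.sum_sub_distrib, sum_range_sum_Ico hs0 hs, ← Finset.mul_sum, ← Finset.sum_mul,
        ← Finset.mul_sum] at h2
      have h6 : ∑ k ∈ Finset.range (s n), (1 / 2 : ℝ) ^ k ≤ 2 :=
        sum_le_hasSum _ (fun _ _ => by positivity) hasSum_geometric_two
      have h7 := mul_le_mul_of_nonneg_right h6 (norm_nonneg a)
      linarith
    have h := (ellOne_summable_norm a).tsum_le_of_sum_range_le hpart
    rw [← ellOne_norm_eq] at h
    linarith [norm_nonneg a, norm_nonneg (V (T a))]
  -- The bound below for `V ∘ T` already gives the one for `T`, through `‖V‖`; the factor `1 / 16`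
  -- combines it with `‖T a‖ ≤ 8 * ‖a‖`.
  refine ⟨T, fun a => ?_, min (1 / 16) (1 / (2 * (‖V‖ + 1))), by positivity, fun a => ?_,
    fun a => ?_⟩
  · refine (Submodule.isClosed_topologicalClosure _).mem_of_tendsto (hT a)
      (Eventually.of_forall fun t => ?_)
    refine Submodule.le_topologicalClosure _ (Submodule.sum_mem _ fun i _ => ?_)
    refine Submodule.smul_mem _ _ (Submodule.smul_mem _ _ (Submodule.sum_mem _ fun k _ => ?_))
    exact Submodule.subset_span ⟨v k, rfl⟩
  · have h1 := (hVT a).trans (V.le_opNorm (T a))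
    refine (mul_le_mul_of_nonneg_right (min_le_right _ _) (norm_nonneg a)).trans ?_
    rw [one_div, inv_mul_le_iff₀ (by positivity)]
    linarith [norm_nonneg (T a)]
  · refine (mul_le_mul_of_nonneg_right (min_le_left _ _) (norm_nonneg (T a))).trans ?_
    linarith [hVT a, hTb a]

end Blocks

end AzimiHagler

end

theorem mainTheorem11 (𝕜 : Type*) [RCLike 𝕜] (w : AzimiHaglerWeight) :
    IsWeaklyCompact 𝕜 (Set.range (AzimiHagler.z 𝕜 w) ∪ {0}) ∧
    (∀ V : AzimiHaglerSpace 𝕜 w →L[𝕜] AzimiHaglerSpace 𝕜 w,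
      ApproximatesIdOn V (Set.range (AzimiHagler.z 𝕜 w) ∪ {0}) (1 / 10) →
        FixesEllOneCopyIn V (Submodule.span 𝕜 (Set.range (AzimiHagler.z 𝕜 w))).topologicalClosure ∧
        ¬ IsWeaklyCompactOperator V) ∧
    ¬ HasUnboundedWAP 𝕜 (AzimiHaglerSpace 𝕜 w) ∧
    ¬ HasWAP 𝕜 (AzimiHaglerSpace 𝕜 w) := by
  have h1 : IsWeaklyCompact 𝕜 (Set.range (AzimiHagler.z 𝕜 w) ∪ {0}) :=
    isWeaklyCompact_range_union_zero AzimiHagler.tendsto_apply_z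
  have h2 : ∀ V : AzimiHaglerSpace 𝕜 w →L[𝕜] AzimiHaglerSpace 𝕜 w,
      ApproximatesIdOn V (Set.range (AzimiHagler.z 𝕜 w) ∪ {0}) (1 / 10) →
        FixesEllOneCopyIn V
          (Submodule.span 𝕜 (Set.range (AzimiHagler.z 𝕜 w))).topologicalClosure := by
    rintro V ⟨δ, hδ, hV⟩
    refine AzimiHagler.fixesEllOneCopyIn_of_le_diagonal V fun n => ?_
    -- Coordinates are bounded by the norm, so the diagonal entry is within `1 / 10` of the
    -- coordinate 1 of `z n`.
    have h3 := (AzimiHagler.norm_coords_le (AzimiHagler.z 𝕜 w n - V (AzimiHagler.z 𝕜 w n))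
      (2 * n + 1)).trans (hV _ (Or.inl ⟨n, rfl⟩))
    rw [AzimiHagler.coords_sub, Pi.sub_apply, AzimiHagler.coords_z_self] at h3
    have h4 := norm_sub_norm_le (1 : 𝕜) (AzimiHagler.coords (V (AzimiHagler.z 𝕜 w n)) (2 * n + 1))
    rw [norm_one] at h4
    linarith
  refine ⟨h1, fun V hV => ⟨h2 V hV, (h2 V hV).not_isWeaklyCompactOperator⟩, fun h => ?_, ?_⟩
  · obtain ⟨V, hVc, hV⟩ := h _ h1 (1 / 10) (by norm_num)
    exact (h2 V hV).not_isWeaklyCompactOperator hVc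
  · rintro ⟨C, h⟩
    obtain ⟨V, hVc, hV, -⟩ := h _ h1 (1 / 10) (by norm_num)
    exact (h2 V hV).not_isWeaklyCompactOperator hVc
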